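/- Let $\mathbb{R}_+=[0,\infty)$, let $L^\infty(\mathbb{R}_+)$ be the space of real-valued essentially bounded measurable functions, let $C_{ub}(\mathbb{R}_+)\subseteq L^\infty(\mathbb{R}_+)$ be the space of bounded uniformly continuous functions, and give $L^\infty(\mathbb{R}_+)^*$ its weak* topology. A mean on $L^\infty(\mathbb{R}_+)$ is a positive linear functional $\varphi$ with $\varphi(1)=1$. Let $\mathcal{M}_1$ be the set of means $\varphi$ on $L^\infty(\mathbb{R}_+)$ such that $$\varphi(f)\le \lim_{\theta\to\infty}\limsup_{x\to\infty}\frac1\theta\int_x^{x+\theta}f(t)\,dt\qquad\text{for every } f\in L^\infty(\mathbb{R}_+).$$ Let $\Omega^*$ be the set of ultrafilters on $\mathbb{R}_+$ of the form $\omega=\{t+A: A\in\eta\}$ (more precisely, the ultrafilters generated by these sets), where $\eta$ is a nonprincipal ultrafilter on $\mathbb{N}_0=\{0,1,2,\dots\}$ and $t\in[0,1]$. For $\omega\in\Omega^*$ and $f\in L^\infty(\mathbb{R}_+)$ let $f_\omega\in L^\infty(\mathbb{R}_+)$ be the limit along $\omega$ (as $s$ varies) of the translates $f_s(x)=f(x+s)$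 in the weak* topology of $L^\infty(\mathbb{R}_+)=L^1(\mathbb{R}_+)^*$; for $f\in C_{ub}(\mathbb{R}_+)$ this is the function $f_\omega(x)=\omega\text{-}\lim_s f(x+s)$. For $\omega\in\Omega^*$ and an ultrafilter $\mathcal{U}$ on $\mathbb{R}_+$ that contains no bounded set, let $\varphi_\omega^{\mathcal{U}}$ be the mean on $C_{ub}(\mathbb{R}_+)$ given by $$\varphi_\omega^{\mathcal{U}}(f)=\mathcal{U}\text{-}\lim_x\frac1x\int_0^x f_\omega(t)\,dt .$$ Then each $\varphi_\omega^{\mathcal{U}}$ has exactly one extension $\overline{\varphi}_\omega^{\mathcal{U}}$ to $L^\infty(\mathbb{R}_+)$ that belongs to $\mathcal{M}_1$, and this extension is given by the same formula, $$\overline{\varphi}_\omega^{\mathcal{U}}(f)=\mathcal{U}\text{-}\lim_x\frac1x\int_0^x f_\omega(t)\,dt\qquad (f\in L^\infty(\mathbb{R}_+)).$$ Moreover, if $\mathcal{Q}_1$ denotes the set of all these extensions $\overline{\varphi}_\omega^{\mathcal{U}}$, then $$\mathcal{M}_1=\overline{\mathrm{co}}(\mathcal{Q}_1),$$ the weak*-closed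 convex hull of $\mathcal{Q}_1$. -/

import Mathlib

open MeasureTheory Filter Topology
open scoped ENNReal NNReal BoundedContinuousFunction

namespace InvMean

/-- `L^∞(ℝ_+)`: real-valued essentially bounded measurable functions on `[0, ∞)`, modulo a.e.
equality. -/
abbrev LInf : Type := Lp ℝ ∞ (volume.restrict (Set.Ici (0 : ℝ)))

/-- The constant function `1` in `L^∞(ℝ_+)`. -/
noncomputable def oneLInf : LInf :=
  (memLp_top_const (μ := volume.restrict (Set.Ici (0 : ℝ))) (1 : ℝ)).toLp

/-- `C_ub(ℝ_+)`: bounded uniformly continuous real functions on `[0, ∞)`. -/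
def Cub : Type := {f : ℝ≥0 →ᵇ ℝ // UniformContinuous f}

lemma memLp_cub (f : Cub) :
    MemLp (fun x : ℝ => f.1 x.toNNReal) ∞ (volume.restrict (Set.Ici (0 : ℝ))) :=
  memLp_top_of_bound
    ((f.1.continuous.comp continuous_real_toNNReal).aestronglyMeasurable) ‖f.1‖
    (Eventually.of_forall fun x => f.1.norm_coe_le_norm x.toNNReal)

/-- The inclusion `C_ub(ℝ_+) ⊆ L^∞(ℝ_+)`. -/
noncomputable def Cub.toLInf (f : Cub) : LInf := (memLp_cub f).toLp

/-- A mean on `L^∞(ℝ_+)`: a normalized positive (continuous) linear functional. The dual space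
carries its weak* topology. -/
def IsMean (φ : WeakDual ℝ LInf) : Prop :=
  (∀ f : LInf, 0 ≤ f → 0 ≤ φ f) ∧ φ oneLInf = 1

/-- `L = lim_{θ → ∞} limsup_{x → ∞} (1/θ) ∫_x^{x+θ} f(t) dt`. -/
def IsUpperMean (f : LInf) (L : ℝ) : Prop :=
  Tendsto (fun θ : ℝ => limsup (fun x : ℝ => (1 / θ) * ∫ t in x..(x + θ), f t) atTop)
    atTop (𝓝 L)

/-- The class `𝓜₁` of means `φ` on `L^∞(ℝ_+)` such that, for every `f`, the value `φ f` is at most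
`lim_{θ → ∞} limsup_{x → ∞} (1/θ) ∫_x^{x+θ} f(t) dt`. -/
def M1 : Set (WeakDual ℝ LInf) :=
  {φ | IsMean φ ∧ ∀ f : LInf, ∃ L : ℝ, IsUpperMean f L ∧ φ f ≤ L}

/-- `Ω*`: the points `ω = (η, t)`, with `η` a nonprincipal ultrafilter on `ℕ` and `t ∈ [0, 1]`,
each identified with the ultrafilter `{t + A : A ∈ η}` on `ℝ_+`. The points `(η, 1)` and
`(η + 1, 0)` give the same ultrafilter. -/
def OmegaStar : Set (Ultrafilter ℝ≥0) :=
  {ω | ∃ η : Ultrafilter ℕ, (∀ n : ℕ, η ≠ pure n) ∧ ∃ t : ℝ≥0, t ≤ 1 ∧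
    ω = η.map (fun n : ℕ => (n : ℝ≥0) + t)}

/-- The ultrafilters on `ℝ_+` that contain no bounded set. -/
def FreeAtInfinity : Set (Ultrafilter ℝ≥0) :=
  {U | ∀ A ∈ U, ¬ Bornology.IsBounded A}

/-- For `f ∈ C_ub(ℝ_+)`, the function `f_ω(s) = ω-lim_x f(x + s)`, `s ≥ 0`; that is, the
continuous extension of `f` evaluated along the forward orbit of `ω`. -/
noncomputable def Cub.orbit (ω : Ultrafilter ℝ≥0) (f : Cub) (s : ℝ≥0) : ℝ :=
  limUnder (ω : Filter ℝ≥0) (fun x : ℝ≥0 => f.1 (x + s))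

/-- The limit that defines `Cub.orbit` always exists. -/
lemma Cub.tendsto_orbit (ω : Ultrafilter ℝ≥0) (f : Cub) (s : ℝ≥0) :
    Tendsto (fun x : ℝ≥0 => f.1 (x + s)) ω (𝓝 (Cub.orbit ω f s)) := by
  have hc : IsCompact (Metric.closedBall (0 : ℝ) ‖f.1‖) := isCompact_closedBall _ _
  have hmem : Metric.closedBall (0 : ℝ) ‖f.1‖ ∈ ω.map (fun x : ℝ≥0 => f.1 (x + s)) := by
    refine Ultrafilter.mem_map.2 (Filter.mem_of_superset univ_mem fun x _ => ?_)
    simpa using f.1.norm_coe_le_norm (x + s)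
  obtain ⟨y, -, hy⟩ := hc.ultrafilter_le_nhds' _ hmem
  exact tendsto_nhds_limUnder ⟨y, hy⟩

/-- `φ` extends the mean `φ_ω^𝓤` on `C_ub(ℝ_+)`,
where `φ_ω^𝓤(f) = 𝓤-lim_x (1/x) ∫_0^x f_ω(t) dt`. -/
def Extends (ω U : Ultrafilter ℝ≥0) (φ : WeakDual ℝ LInf) : Prop :=
  ∀ f : Cub, Tendsto
    (fun x : ℝ≥0 => (1 / (x : ℝ)) * ∫ t in (0 : ℝ)..(x : ℝ), Cub.orbit ω f t.toNNReal)
    U (𝓝 (φ f.toLInf))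

/-- The set `𝓠₁` of all extensions, within `𝓜₁`, of the means `φ_ω^𝓤` on `C_ub(ℝ_+)`. -/
def Q1 : Set (WeakDual ℝ LInf) :=
  {φ | φ ∈ M1 ∧ ∃ ω ∈ OmegaStar, ∃ U ∈ FreeAtInfinity, Extends ω U φ}

/-- For `f ∈ L^∞(ℝ_+)`: `g = f_ω`, the limit along `ω` of the translates `f_s(x) = f(x + s)` for
the weak* topology of `L^∞(ℝ_+)` as the dual of `L^1(ℝ_+)`. -/
def IsOrbitLimit (ω : Ultrafilter ℝ≥0) (f g : LInf) : Prop :=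
  ∀ h : ℝ → ℝ, IntegrableOn h (Set.Ici 0) →
    Tendsto (fun s : ℝ≥0 => ∫ x in Set.Ici (0 : ℝ), f (x + (s : ℝ)) * h x)
      ω (𝓝 (∫ x in Set.Ici (0 : ℝ), g x * h x))

/-- `φ(f) = 𝓤-lim_x (1/x) ∫_0^x f_ω(t) dt` for every `f ∈ L^∞(ℝ_+)`, including the existence of
`f_ω` and of the limit. -/
def IsCesaroLimit (ω U : Ultrafilter ℝ≥0) (φ : WeakDual ℝ LInf) : Prop :=
  ∀ f : LInf, ∃ g : LInf, IsOrbitLimit ω f g ∧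
    Tendsto (fun x : ℝ≥0 => (1 / (x : ℝ)) * ∫ t in (0 : ℝ)..(x : ℝ), g t) U (𝓝 (φ f))

end InvMean

/-! Everything is read off the primitive `F = prim f`, which is Lipschitz with constant `‖f‖`.
Window averages of `f` are difference quotients of `F`, and the primitive of `f_ω` is the `ω`-limit
of `F (s + x) - F s` (`orbitPrim`). So `cesaro ω U` can be defined and estimated without `f_ω`
itself; `isCesaroLimit_iff` translates back.

Extension: bounds on windows of length `θ` pass to `f_ω`, hence to its averages over `[0, x]` up to
`O(θ / x)`, so `cesaro ω U` lies in `M1`. Conversely, every member of `M1` vanishes on functions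
with bounded primitive. The difference between `f` and its moving average in `C_ub` is such a
function, so members of `M1` are determined on `C_ub` (`mem_M1_and_extends_iff`).

Convex hull: `M1` is convex and weak* closed. By Hahn–Banach it suffices that, for each `f`, `Q1`
takes values at `f` arbitrarily close to the upper mean `L`. For `c < L`, a minimum point of `F y -
c * y` on a long window of large average has all its forward averages at least `c`
(`exists_forall_le_prim_sub`). A limit of such points is the required `ω`, and any `U` then works.
-/

namespace InvMean

/-! ### Primitives of bounded functions -/

/-- A function in `L^∞(ℝ_+)`, extended by `0` to the whole line. -/
noncomputable def ext (f : LInf) : ℝ → ℝ := (Set.Ici (0 : ℝ)).indicator f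

/-- The primitive of `f ∈ L^∞(ℝ_+)` that vanishes at `0`. -/
noncomputable def prim (f : LInf) (x : ℝ) : ℝ := ∫ t in (0 : ℝ)..x, ext f t

lemma aestronglyMeasurable_ext (f : LInf) : AEStronglyMeasurable (ext f) volume :=
  (aestronglyMeasurable_indicator_iff measurableSet_Ici).2 (Lp.aestronglyMeasurable f)

lemma ae_abs_le_norm (f : LInf) :
    ∀ᵐ x ∂(volume.restrict (Set.Ici (0 : ℝ))), |f x| ≤ ‖f‖ := by
  have h := ae_le_eLpNormEssSup (f := f) (μ := volume.restrict (Set.Ici (0 : ℝ)))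
  filter_upwards [h] with x hx
  rw [Lp.norm_def, eLpNorm_exponent_top, ← Real.norm_eq_abs, ← toReal_enorm]
  refine ENNReal.toReal_mono ?_ hx
  rw [← eLpNorm_exponent_top]
  exact (Lp.memLp f).eLpNorm_ne_top

lemma ae_abs_ext_le (f : LInf) : ∀ᵐ x, |ext f x| ≤ ‖f‖ := by
  filter_upwards [(ae_restrict_iff' measurableSet_Ici).1 (ae_abs_le_norm f)] with x hx
  by_cases h : x ∈ Set.Ici (0 : ℝ)
  · simpa [ext, h] using hx h
  · simp [ext, h]

lemma intervalIntegrable_ext (f : LInf) (a b : ℝ) : IntervalIntegrable (ext f) volume a b := by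
  refine (intervalIntegrable_const (c := ‖f‖)).mono_fun
    (aestronglyMeasurable_ext f).restrict ?_
  refine ae_restrict_of_ae ?_
  filter_upwards [ae_abs_ext_le f] with x hx
  simpa using hx

lemma prim_sub (f : LInf) (a b : ℝ) : prim f b - prim f a = ∫ t in a..b, ext f t :=
  intervalIntegral.integral_interval_sub_left (intervalIntegrable_ext f _ _)
    (intervalIntegrable_ext f _ _)

lemma integral_eq_prim_sub (f : LInf) {a b : ℝ} (ha : 0 ≤ a) (hb : 0 ≤ b) :
    ∫ t in a..b, f t = prim f b - prim f a := by
  rw [prim_sub]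
  refine intervalIntegral.integral_congr fun x hx => ?_
  have : x ∈ Set.Ici (0 : ℝ) := (le_min ha hb).trans hx.1
  simp [ext, this]

lemma prim_zero (f : LInf) : prim f 0 = 0 := by simp [prim]

lemma integral_zero_eq_prim (f : LInf) {b : ℝ} (hb : 0 ≤ b) :
    ∫ t in (0 : ℝ)..b, f t = prim f b := by
  rw [integral_eq_prim_sub f le_rfl hb, prim_zero, sub_zero]

lemma abs_prim_sub_le (f : LInf) (a b : ℝ) : |prim f b - prim f a| ≤ ‖f‖ * |b - a| := by
  rw [prim_sub, ← Real.norm_eq_abs]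
  refine intervalIntegral.norm_integral_le_of_norm_le_const_ae ?_
  filter_upwards [ae_abs_ext_le f] with x hx _ using hx

lemma prim_congr {f : LInf} {h : ℝ → ℝ}
    (hf : f =ᵐ[volume.restrict (Set.Ici (0 : ℝ))] h) {x : ℝ} (hx : 0 ≤ x) :
    prim f x = ∫ t in (0 : ℝ)..x, h t := by
  rw [← integral_zero_eq_prim f hx]
  refine intervalIntegral.integral_congr_ae ?_
  filter_upwards [(ae_restrict_iff' measurableSet_Ici).1 hf] with t ht htx
  rw [Set.uIoc_of_le hx] at htx
  exact ht htx.1.le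

lemma ext_congr {f : LInf} {h : ℝ → ℝ}
    (hf : f =ᵐ[volume.restrict (Set.Ici (0 : ℝ))] h) :
    ext f =ᵐ[volume] (Set.Ici (0 : ℝ)).indicator h := by
  filter_upwards [(ae_restrict_iff' measurableSet_Ici).1 hf] with x hx
  by_cases h : x ∈ Set.Ici (0 : ℝ)
  · simpa [ext, h] using hx h
  · simp [ext, h]

lemma prim_add (f g : LInf) (x : ℝ) : prim (f + g) x = prim f x + prim g x := by
  unfold prim
  rw [← intervalIntegral.integral_add (intervalIntegrable_ext f _ _)
    (intervalIntegrable_ext g _ _)]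
  refine intervalIntegral.integral_congr_ae ?_
  filter_upwards [ext_congr (Lp.coeFn_add f g)] with t ht _
  rw [ht, Set.indicator_add']
  rfl

lemma prim_smul (c : ℝ) (f : LInf) (x : ℝ) : prim (c • f) x = c * prim f x := by
  unfold prim
  rw [← intervalIntegral.integral_const_mul]
  refine intervalIntegral.integral_congr_ae ?_
  filter_upwards [ext_congr (Lp.coeFn_smul c f)] with t ht _
  rw [ht]
  exact congrFun (Set.indicator_const_smul _ c f) t

lemma prim_neg (f : LInf) (x : ℝ) : prim (-f) x = -prim f x := by
  simpa using prim_smul (-1) f x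

lemma prim_one {x : ℝ} (hx : 0 ≤ x) : prim oneLInf x = x := by
  rw [prim_congr (f := oneLInf) (h := fun _ => 1) (MemLp.coeFn_toLp _) hx]
  simp

lemma prim_mono_of_nonneg {f : LInf} (hf : 0 ≤ f) {a b : ℝ} (hab : a ≤ b) :
    prim f a ≤ prim f b := by
  rw [← sub_nonneg, prim_sub]
  refine intervalIntegral.integral_nonneg_of_ae hab ?_
  have h := (ae_restrict_iff' measurableSet_Ici).1 ((Lp.coeFn_nonneg f).2 hf)
  filter_upwards [h] with x hx
  exact Set.indicator_apply_nonneg hx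

/-! ### Lipschitz functions and sliding windows -/

lemma continuous_of_abs_sub_le {F : ℝ → ℝ} {C : ℝ} (hF : ∀ a b, |F b - F a| ≤ C * |b - a|) :
    Continuous F := by
  have hC : 0 ≤ C := by simpa using (abs_nonneg _).trans (hF 0 1)
  exact (LipschitzWith.of_dist_le_mul (K := C.toNNReal) fun a b => by
    simpa [Real.dist_eq, hC] using hF b a).continuous

/-- Sliding the window `[x, x + T]` by `θ` changes the integral of `F` only at its two ends. -/
lemma integral_window_eq {F : ℝ → ℝ} (hF : Continuous F) (x T θ : ℝ) :
    ∫ t in x..(x + T), (F (t + θ) - F t) =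
      (∫ t in (x + T)..(x + T + θ), F t) - ∫ t in x..(x + θ), F t := by
  have hi : ∀ a b, IntervalIntegrable F volume a b := fun a b => hF.intervalIntegrable a b
  rw [intervalIntegral.integral_sub
    ((by fun_prop : Continuous fun t => F (t + θ)).intervalIntegrable _ _) (hi _ _),
    intervalIntegral.integral_comp_add_right (fun t => F t),
    intervalIntegral.integral_interval_sub_interval_comm (hi _ _) (hi _ _) (hi _ _),
    intervalIntegral.integral_symm x (x + θ), intervalIntegral.integral_symm (x + T + θ)]
  ring

lemma abs_integral_window_sub_le {F : ℝ → ℝ} {C : ℝ} (hF : ∀ a b, |F b - F a| ≤ C * |b - a|)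
    (y : ℝ) {θ : ℝ} (hθ : 0 ≤ θ) :
    |(∫ t in y..(y + θ), F t) - θ * F y| ≤ C * θ * θ := by
  have hC : 0 ≤ C := by simpa using (abs_nonneg _).trans (hF 0 1)
  have e : (∫ t in y..(y + θ), F t) - θ * F y = ∫ t in y..(y + θ), (F t - F y) := by
    rw [intervalIntegral.integral_sub ((continuous_of_abs_sub_le hF).intervalIntegrable _ _)
      intervalIntegrable_const]
    simp
  rw [e, ← Real.norm_eq_abs]
  refine (intervalIntegral.norm_integral_le_of_norm_le_const (C := C * θ) fun t ht => ?_).trans ?_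
  · rw [Set.uIoc_of_le (by linarith)] at ht
    refine (hF y t).trans (mul_le_mul_of_nonneg_left ?_ hC)
    rw [abs_of_pos (by linarith [ht.1])]
    linarith [ht.2]
  · simp [abs_of_nonneg hθ]

/-- If all averages of the slope over windows of length `θ` are at most `m`, then so is the average over
a long window, up to a boundary term. -/
lemma sub_le_of_window_le {F : ℝ → ℝ} {C : ℝ} (hF : ∀ a b, |F b - F a| ≤ C * |b - a|)
    {x T θ m : ℝ} (hT : 0 ≤ T) (hθ : 0 < θ)
    (h : ∀ t ∈ Set.Icc x (x + T), F (t + θ) - F t ≤ θ * m) :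
    F (x + T) - F x ≤ T * m + 2 * C * θ := by
  have hcont := continuous_of_abs_sub_le hF
  -- Integrate the hypothesis over `t`. By the sliding identity the left side is within `2 * C * θ *
  -- θ` of `θ * (F (x + T) - F x)`; then divide by `θ`.
  have e1 := integral_window_eq hcont x T θ
  have e2 := intervalIntegral.integral_mono_on (μ := volume) (by linarith : x ≤ x + T)
    ((by fun_prop : Continuous fun t => F (t + θ) - F t).intervalIntegrable _ _)
    (intervalIntegrable_const (c := θ * m)) h
  rw [intervalIntegral.integral_const, smul_eq_mul] at e2
  have e3 := abs_le.1 (abs_integral_window_sub_le hF (x + T) hθ.le)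
  have e4 := abs_le.1 (abs_integral_window_sub_le hF x hθ.le)
  have : θ * (F (x + T) - F x) ≤ θ * (T * m + 2 * C * θ) := by linarith [e3.1, e4.2]
  exact le_of_mul_le_mul_left this hθ

/-! ### Existence of the upper mean -/

/-- The upper limit of the averages of `f` over windows of length `θ`. -/
noncomputable def upperAvg (f : LInf) (θ : ℝ) : ℝ :=
  limsup (fun x : ℝ => (prim f (x + θ) - prim f x) / θ) atTop

lemma limsup_avg_eq (f : LInf) {θ : ℝ} (hθ : 0 < θ) :
    limsup (fun x : ℝ => (1 / θ) * ∫ t in x..(x + θ), f t) atTop = upperAvg f θ := by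
  refine limsup_congr ?_
  filter_upwards [eventually_ge_atTop 0] with x hx
  rw [integral_eq_prim_sub f hx (by linarith)]
  ring

lemma isUpperMean_iff {f : LInf} {L : ℝ} :
    IsUpperMean f L ↔ Tendsto (upperAvg f) atTop (𝓝 L) := by
  refine tendsto_congr' ?_
  filter_upwards [eventually_gt_atTop 0] with θ hθ using limsup_avg_eq f hθ

lemma abs_avg_le (f : LInf) {θ : ℝ} (hθ : 0 < θ) (x : ℝ) :
    |(prim f (x + θ) - prim f x) / θ| ≤ ‖f‖ := by
  rw [abs_div, abs_of_pos hθ, div_le_iff₀ hθ]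
  simpa [abs_of_pos hθ] using abs_prim_sub_le f x (x + θ)

lemma isBoundedUnder_avg (f : LInf) {θ : ℝ} (hθ : 0 < θ) :
    IsBoundedUnder (· ≤ ·) atTop (fun x : ℝ => (prim f (x + θ) - prim f x) / θ) :=
  isBoundedUnder_of ⟨‖f‖, fun x => (abs_le.1 (abs_avg_le f hθ x)).2⟩

lemma isCoboundedUnder_avg (f : LInf) {θ : ℝ} (hθ : 0 < θ) :
    IsCoboundedUnder (· ≤ ·) atTop (fun x : ℝ => (prim f (x + θ) - prim f x) / θ) :=
  (isBoundedUnder_of (r := (· ≥ ·)) ⟨-‖f‖, fun x => (abs_le.1 (abs_avg_le f hθ x)).1⟩).isCoboundedUnder_le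

lemma eventually_window_le {f : LInf} {θ m : ℝ} (hθ : 0 < θ) (hm : upperAvg f θ < m) :
    ∀ᶠ x in atTop, prim f (x + θ) - prim f x ≤ θ * m := by
  filter_upwards [eventually_lt_of_limsup_lt hm (isBoundedUnder_avg f hθ)] with x hx
  rw [div_lt_iff₀ hθ] at hx
  linarith

lemma upperAvg_le {f : LInf} {θ m : ℝ} (hθ : 0 < θ)
    (h : ∀ᶠ x in atTop, prim f (x + θ) - prim f x ≤ θ * m) : upperAvg f θ ≤ m := by
  refine limsup_le_of_le (isCoboundedUnder_avg f hθ) ?_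
  filter_upwards [h] with x hx
  rw [div_le_iff₀ hθ]
  linarith

lemma abs_upperAvg_le (f : LInf) {θ : ℝ} (hθ : 0 < θ) : |upperAvg f θ| ≤ ‖f‖ := by
  refine abs_le.2 ⟨?_, ?_⟩
  · exact le_limsup_of_frequently_le
      (Eventually.of_forall fun x => (abs_le.1 (abs_avg_le f hθ x)).1).frequently
      (isBoundedUnder_avg f hθ)
  · exact limsup_le_of_le (isCoboundedUnder_avg f hθ)
      (Eventually.of_forall fun x => (abs_le.1 (abs_avg_le f hθ x)).2)

lemma upperAvg_le_add (f : LInf) {θ T : ℝ} (hθ : 0 < θ) (hT : 0 < T) :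
    upperAvg f T ≤ upperAvg f θ + 2 * ‖f‖ * θ / T := by
  refine le_of_forall_pos_le_add fun ε hε => upperAvg_le hT ?_
  obtain ⟨N, hN⟩ := eventually_atTop.1
    (eventually_window_le hθ (lt_add_of_pos_right (upperAvg f θ) hε))
  filter_upwards [eventually_ge_atTop N] with x hx
  refine (sub_le_of_window_le (abs_prim_sub_le f) hT.le hθ
    (fun t ht => hN t (hx.trans ht.1))).trans_eq ?_
  field_simp
  ring

/-- Letting `T → ∞` in `upperAvg_le_add` bounds the limsup of `upperAvg f` by each single `upperAvg
f θ`, hence by the liminf. -/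
lemma exists_isUpperMean (f : LInf) : ∃ L, IsUpperMean f L := by
  have hb : ∀ᶠ θ in atTop, |upperAvg f θ| ≤ ‖f‖ := by
    filter_upwards [eventually_gt_atTop 0] with θ hθ using abs_upperAvg_le f hθ
  have hle : IsBoundedUnder (· ≤ ·) atTop (upperAvg f) :=
    ⟨‖f‖, eventually_map.2 (hb.mono fun θ h => (abs_le.1 h).2)⟩
  have hge : IsBoundedUnder (· ≥ ·) atTop (upperAvg f) :=
    ⟨-‖f‖, eventually_map.2 (hb.mono fun θ h => (abs_le.1 h).1)⟩
  refine ⟨limsup (upperAvg f) atTop, isUpperMean_iff.2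
    (tendsto_of_le_liminf_of_limsup_le ?_ le_rfl hle hge)⟩
  refine le_liminf_of_le hle.isCoboundedUnder_ge ?_
  filter_upwards [eventually_gt_atTop 0] with θ hθ
  have ht : Tendsto (fun T => upperAvg f θ + 2 * ‖f‖ * θ / T) atTop (𝓝 (upperAvg f θ)) := by
    simpa using (tendsto_const_nhds (x := upperAvg f θ)).add
      (tendsto_const_nhds (x := 2 * ‖f‖ * θ) |>.div_atTop tendsto_id)
  rw [← ht.limsup_eq]
  refine limsup_le_limsup ?_ hge.isCoboundedUnder_le ht.isBoundedUnder_le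
  filter_upwards [eventually_gt_atTop 0] with T hT using upperAvg_le_add f hθ hT

lemma IsUpperMean.le_of_forall {f : LInf} {L c : ℝ} (hL : IsUpperMean f L)
    (h : ∀ θ > 0, c ≤ upperAvg f θ) : c ≤ L :=
  ge_of_tendsto (isUpperMean_iff.1 hL) (by
    filter_upwards [eventually_gt_atTop 0] with θ hθ using h θ hθ)

/-! ### Ultrafilter limits and the primitive of `f_ω` -/

lemma tendsto_limUnder_of_abs_le {α : Type*} (U : Ultrafilter α) {u : α → ℝ} {C : ℝ}
    (h : ∀ x, |u x| ≤ C) : Tendsto u U (𝓝 (limUnder (U : Filter α) u)) := by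
  obtain ⟨y, -, hy⟩ := (isCompact_closedBall (0 : ℝ) C).ultrafilter_le_nhds' (U.map u)
    (Ultrafilter.mem_map.2 (mem_of_superset univ_mem fun x _ => by simpa using h x))
  exact tendsto_nhds_limUnder ⟨y, hy⟩

lemma le_atTop_of_mem_freeAtInfinity {U : Ultrafilter ℝ≥0} (hU : U ∈ FreeAtInfinity) :
    (U : Filter ℝ≥0) ≤ atTop := by
  refine le_iInf fun a => le_principal_iff.2 ?_
  by_contra h
  have h' := Ultrafilter.compl_mem_iff_notMem.2 h
  refine hU _ h' ((Metric.isBounded_Icc 0 a).subset fun x hx => ?_)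
  exact ⟨zero_le, (not_le.1 (Set.mem_Ici.not.1 hx)).le⟩

lemma le_atTop_of_mem_omegaStar {ω : Ultrafilter ℝ≥0} (hω : ω ∈ OmegaStar) :
    (ω : Filter ℝ≥0) ≤ atTop := by
  obtain ⟨η, hη, t, -, h⟩ := hω
  have h1 : (η : Filter ℕ) ≤ atTop := by
    rw [← Nat.cofinite_eq_atTop]
    refine (Ultrafilter.le_cofinite_or_eq_pure η).resolve_right ?_
    rintro ⟨n, hn⟩
    exact hη n hn
  have h2 : Tendsto (fun n : ℕ => (n : ℝ≥0) + t) atTop atTop :=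
    tendsto_atTop_mono (fun n => le_self_add) (tendsto_natCast_atTop_atTop (R := ℝ≥0))
  rw [h, Ultrafilter.coe_map]
  exact h2.mono_left h1

/-- The primitive of `f_ω`: the limit along `ω` of the primitives of the translates of `f`. -/
noncomputable def orbitPrim (ω : Ultrafilter ℝ≥0) (f : LInf) (x : ℝ) : ℝ :=
  limUnder (ω : Filter ℝ≥0) (fun s : ℝ≥0 => prim f (s + x) - prim f s)

lemma tendsto_orbitPrim (ω : Ultrafilter ℝ≥0) (f : LInf) (x : ℝ) :
    Tendsto (fun s : ℝ≥0 => prim f (s + x) - prim f s) ω (𝓝 (orbitPrim ω f x)) :=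
  tendsto_limUnder_of_abs_le ω (C := ‖f‖ * |x|) fun s => by
    simpa using abs_prim_sub_le f s (s + x)

lemma tendsto_orbitPrim_sub (ω : Ultrafilter ℝ≥0) (f : LInf) (a b : ℝ) :
    Tendsto (fun s : ℝ≥0 => prim f (s + b) - prim f (s + a)) ω
      (𝓝 (orbitPrim ω f b - orbitPrim ω f a)) := by
  simpa using (tendsto_orbitPrim ω f b).sub (tendsto_orbitPrim ω f a)

lemma abs_orbitPrim_sub_le (ω : Ultrafilter ℝ≥0) (f : LInf) (a b : ℝ) :
    |orbitPrim ω f b - orbitPrim ω f a| ≤ ‖f‖ * |b - a| :=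
  le_of_tendsto (tendsto_orbitPrim_sub ω f a b).abs
    (Eventually.of_forall fun s => by simpa using abs_prim_sub_le f (s + a) (s + b))

lemma orbitPrim_zero (ω : Ultrafilter ℝ≥0) (f : LInf) : orbitPrim ω f 0 = 0 :=
  tendsto_nhds_unique (tendsto_orbitPrim ω f 0) (by simp)

lemma abs_orbitPrim_le (ω : Ultrafilter ℝ≥0) (f : LInf) (x : ℝ) :
    |orbitPrim ω f x| ≤ ‖f‖ * |x| := by
  simpa [orbitPrim_zero] using abs_orbitPrim_sub_le ω f 0 x

lemma orbitPrim_add (ω : Ultrafilter ℝ≥0) (f g : LInf) (x : ℝ) :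
    orbitPrim ω (f + g) x = orbitPrim ω f x + orbitPrim ω g x := by
  refine tendsto_nhds_unique (tendsto_orbitPrim ω (f + g) x)
    (((tendsto_orbitPrim ω f x).add (tendsto_orbitPrim ω g x)).congr fun s => ?_)
  rw [prim_add, prim_add]
  ring

lemma orbitPrim_smul (ω : Ultrafilter ℝ≥0) (c : ℝ) (f : LInf) (x : ℝ) :
    orbitPrim ω (c • f) x = c * orbitPrim ω f x := by
  refine tendsto_nhds_unique (tendsto_orbitPrim ω (c • f) x)
    (((tendsto_orbitPrim ω f x).const_mul c).congr fun s => ?_)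
  rw [prim_smul, prim_smul]
  ring

lemma abs_cesaro_avg_le (ω : Ultrafilter ℝ≥0) (f : LInf) (x : ℝ≥0) :
    |(1 / (x : ℝ)) * orbitPrim ω f x| ≤ ‖f‖ := by
  -- At `x = 0` the convention `1 / 0 = 0` makes the average vanish.
  rcases eq_or_ne x 0 with rfl | hx
  · simp
  have hx' : (0 : ℝ) < x := NNReal.coe_pos.2 (pos_iff_ne_zero.2 hx)
  rw [abs_mul, abs_of_pos (by positivity : 0 < 1 / (x : ℝ)), one_div, inv_mul_le_iff₀ hx']
  have := abs_orbitPrim_le ω f x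
  rw [abs_of_pos hx'] at this
  linarith

/-! ### Cesàro functionals and their membership in `M1` -/

/-- The functional `f ↦ 𝓤-lim_x (1/x) ∫_0^x f_ω(t) dt`. -/
noncomputable def cesaro (ω U : Ultrafilter ℝ≥0) : WeakDual ℝ LInf :=
  StrongDual.toWeakDual <| LinearMap.mkContinuous
    { toFun := fun f => limUnder (U : Filter ℝ≥0) fun x => (1 / (x : ℝ)) * orbitPrim ω f x
      map_add' := fun f g => by
        refine tendsto_nhds_unique (tendsto_limUnder_of_abs_le U (abs_cesaro_avg_le ω (f + g)))
          (((tendsto_limUnder_of_abs_le U (abs_cesaro_avg_le ω f)).add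
            (tendsto_limUnder_of_abs_le U (abs_cesaro_avg_le ω g))).congr fun x => ?_)
        rw [orbitPrim_add]
        ring
      map_smul' := fun c f => by
        refine tendsto_nhds_unique (tendsto_limUnder_of_abs_le U (abs_cesaro_avg_le ω (c • f)))
          (((tendsto_limUnder_of_abs_le U (abs_cesaro_avg_le ω f)).const_mul c).congr fun x => ?_)
        rw [orbitPrim_smul]
        ring } 1 fun f => by
      rw [one_mul]
      exact le_of_tendsto (tendsto_limUnder_of_abs_le U (abs_cesaro_avg_le ω f)).abs
        (Eventually.of_forall (abs_cesaro_avg_le ω f))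

lemma tendsto_cesaro (ω U : Ultrafilter ℝ≥0) (f : LInf) :
    Tendsto (fun x : ℝ≥0 => (1 / (x : ℝ)) * orbitPrim ω f x) U (𝓝 (cesaro ω U f)) :=
  tendsto_limUnder_of_abs_le U (abs_cesaro_avg_le ω f)

lemma isMean_cesaro (ω : Ultrafilter ℝ≥0) {U : Ultrafilter ℝ≥0}
    (hU : (U : Filter ℝ≥0) ≤ atTop) : IsMean (cesaro ω U) := by
  refine ⟨fun f hf => ?_, ?_⟩
  · refine ge_of_tendsto (tendsto_cesaro ω U f) (Eventually.of_forall fun x => ?_)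
    refine mul_nonneg (by positivity) (ge_of_tendsto (tendsto_orbitPrim ω f x) ?_)
    exact Eventually.of_forall fun s => sub_nonneg.2 (prim_mono_of_nonneg hf (by simp))
  · have h1 : ∀ x : ℝ≥0, orbitPrim ω oneLInf x = x := fun x => by
      refine tendsto_nhds_unique (tendsto_orbitPrim ω oneLInf x)
        (tendsto_const_nhds.congr fun s => ?_)
      rw [prim_one (by positivity), prim_one (by positivity)]
      ring
    refine tendsto_nhds_unique (tendsto_cesaro ω U oneLInf) (tendsto_const_nhds.congr' ?_)
    filter_upwards [hU (eventually_gt_atTop 0)] with x hx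
    rw [h1, one_div_mul_cancel (NNReal.coe_ne_zero.2 hx.ne')]

/-- Since `s + t → ∞` along `ω`, the eventual window bound for `f` holds for `f_ω` at every `t ≥ 0`.
The boundary term of `sub_le_of_window_le` dies after division by `x → ∞`. -/
lemma cesaro_le_upperAvg {ω U : Ultrafilter ℝ≥0} (hω : (ω : Filter ℝ≥0) ≤ atTop)
    (hU : (U : Filter ℝ≥0) ≤ atTop) (f : LInf) {θ : ℝ} (hθ : 0 < θ) :
    cesaro ω U f ≤ upperAvg f θ := by
  refine le_of_forall_pos_le_add fun ε hε => ?_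
  set m := upperAvg f θ + ε with hm
  have hcoe : Tendsto ((↑) : ℝ≥0 → ℝ) U atTop := NNReal.tendsto_coe_atTop.2 hU
  have hwin : ∀ t : ℝ, 0 ≤ t → orbitPrim ω f (t + θ) - orbitPrim ω f t ≤ θ * m := fun t ht => by
    refine le_of_tendsto (tendsto_orbitPrim_sub ω f t (t + θ)) ?_
    have h1 : Tendsto (fun s : ℝ≥0 => (s : ℝ) + t) ω atTop :=
      tendsto_atTop_add_const_right _ _ (NNReal.tendsto_coe_atTop.2 hω)
    filter_upwards [h1.eventually (eventually_window_le hθ (lt_add_of_pos_right _ hε))] with s hs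
    rwa [← add_assoc]
  have hlim : Tendsto (fun x : ℝ≥0 => m + 2 * ‖f‖ * θ / (x : ℝ)) U (𝓝 m) := by
    simpa using (tendsto_const_nhds (x := m)).add
      ((tendsto_const_nhds (x := 2 * ‖f‖ * θ)).div_atTop hcoe)
  refine le_of_tendsto_of_tendsto (tendsto_cesaro ω U f) hlim ?_
  filter_upwards [hcoe.eventually (eventually_gt_atTop 0)] with x hx
  have := sub_le_of_window_le (abs_orbitPrim_sub_le ω f) (x := 0) hx.le hθ
    (fun t ht => hwin t ht.1)
  rw [orbitPrim_zero, zero_add, sub_zero] at this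
  rw [one_div, inv_mul_le_iff₀ hx]
  refine this.trans_eq ?_
  field_simp

lemma cesaro_mem_M1 {ω U : Ultrafilter ℝ≥0} (hω : (ω : Filter ℝ≥0) ≤ atTop)
    (hU : (U : Filter ℝ≥0) ≤ atTop) : cesaro ω U ∈ M1 := by
  refine ⟨isMean_cesaro ω hU, fun f => ?_⟩
  obtain ⟨L, hL⟩ := exists_isUpperMean f
  exact ⟨L, hL, hL.le_of_forall fun θ hθ => cesaro_le_upperAvg hω hU f hθ⟩

/-! ### Weak convergence of uniformly bounded families -/

lemma abs_integral_mul_le {α : Type*} [MeasurableSpace α] {μ : Measure α} {u φ : α → ℝ} {C : ℝ}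
    (hC : ∀ᵐ x ∂μ, |u x| ≤ C) (hφ : Integrable φ μ) :
    |∫ x, u x * φ x ∂μ| ≤ C * ∫ x, |φ x| ∂μ := by
  rw [← integral_const_mul, ← Real.norm_eq_abs]
  refine norm_integral_le_of_norm_le (hφ.abs.const_mul C) ?_
  filter_upwards [hC] with x hx
  rw [norm_mul]
  exact mul_le_mul_of_nonneg_right hx (abs_nonneg _)

lemma integrable_mul_of_abs_le {α : Type*} [MeasurableSpace α] {μ : Measure α} {u φ : α → ℝ}
    {C : ℝ} (hm : AEStronglyMeasurable u μ) (hC : ∀ᵐ x ∂μ, |u x| ≤ C) (hφ : Integrable φ μ) :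
    Integrable (fun x => u x * φ x) μ :=
  hφ.bdd_mul hm hC

section WeakConvergence

variable {ι : Type*} {l : Filter ι} {u : ι → ℝ → ℝ} {C : ℝ}

/-- A π-λ argument: the rays form a generating π-system, and disjoint unions are handled by
dominated convergence of series, with majorant `C * μ.real (t n)`. -/
lemma tendsto_setIntegral_of_Iic {μ : Measure ℝ} [IsFiniteMeasure μ]
    (hm : ∀ i, AEStronglyMeasurable (u i) μ) (hC : ∀ i, ∀ᵐ x ∂μ, |u i x| ≤ C)
    (huniv : Tendsto (fun i => ∫ x, u i x ∂μ) l (𝓝 0))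
    (h : ∀ b, Tendsto (fun i => ∫ x in Set.Iic b, u i x ∂μ) l (𝓝 0))
    {s : Set ℝ} (hs : MeasurableSet s) :
    Tendsto (fun i => ∫ x in s, u i x ∂μ) l (𝓝 0) := by
  have hi : ∀ i, Integrable (u i) μ := fun i =>
    Integrable.of_bound (hm i) C (hC i)
  induction s, hs using MeasurableSpace.induction_on_inter
    ((BorelSpace.measurable_eq (α := ℝ)).trans (borel_eq_generateFrom_Iic ℝ)) isPiSystem_Iic with
  | empty => simpa using tendsto_const_nhds
  | basic t ht =>
    obtain ⟨b, rfl⟩ := ht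
    exact h b
  | compl t ht ih =>
    refine (by simpa using huniv.sub ih : Tendsto (fun i => (∫ x, u i x ∂μ) - ∫ x in t, u i x ∂μ)
      l (𝓝 0)).congr fun i => ?_
    rw [← integral_add_compl ht (hi i)]
    ring
  | iUnion t hd ht ih =>
    have hsum : Summable fun n => C * μ.real (t n) := by
      refine Summable.mul_left C ?_
      refine ENNReal.summable_toReal ?_
      rw [← measure_iUnion hd ht]
      exact measure_ne_top _ _
    have := tendsto_tsum_of_dominated_convergence (f := fun i n => ∫ x in t n, u i x ∂μ)
      (g := fun _ => (0 : ℝ)) hsum ih (Eventually.of_forall fun i n => by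
        have := norm_setIntegral_le_of_norm_le_const_ae (f := u i) (measure_lt_top μ (t n))
          (ae_restrict_of_ae (hC i))
        exact this)
    rw [tsum_zero] at this
    refine this.congr fun i => ?_
    exact (integral_iUnion ht hd (hi i).integrableOn).symm

/-- Simple functions are dense in `L^1`, and the uniform bound `C` controls the error of
approximation for all `i` at once. -/
lemma tendsto_integral_mul_of_setIntegral {μ : Measure ℝ}
    (hm : ∀ i, AEStronglyMeasurable (u i) μ) (hC : ∀ i, ∀ᵐ x ∂μ, |u i x| ≤ C)
    (h : ∀ s, MeasurableSet s → μ s < ∞ → Tendsto (fun i => ∫ x in s, u i x ∂μ) l (𝓝 0))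
    {φ : ℝ → ℝ} (hφ : Integrable φ μ) :
    Tendsto (fun i => ∫ x, u i x * φ x ∂μ) l (𝓝 0) := by
  have key : ∀ i, ∀ {φ : ℝ → ℝ}, Integrable φ μ → Integrable (fun x => u i x * φ x) μ :=
    fun i φ hφ => integrable_mul_of_abs_le (hm i) (hC i) hφ
  refine Integrable.induction (μ := μ)
    (fun φ : ℝ → ℝ => Tendsto (fun i => ∫ x, u i x * φ x ∂μ) l (𝓝 0)) ?_ ?_ ?_ ?_ hφ
  · intro c s hs hμ
    refine (by simpa using (h s hs hμ).mul_const c : Tendsto (fun i => (∫ x in s, u i x ∂μ) * c)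
      l (𝓝 0)).congr fun i => ?_
    rw [← integral_mul_const, ← integral_indicator hs]
    congr 1 with x
    by_cases hx : x ∈ s <;> simp [hx]
  · intro f g _ hf hg h1 h2
    refine (by simpa using h1.add h2 : Tendsto (fun i => (∫ x, u i x * f x ∂μ) +
      ∫ x, u i x * g x ∂μ) l (𝓝 0)).congr fun i => ?_
    rw [← integral_add (key i hf) (key i hg)]
    simp [mul_add]
  · refine isClosed_of_closure_subset fun f hf => ?_
    refine Metric.tendsto_nhds.2 fun ε hε => ?_
    obtain ⟨g, hg, hfg⟩ := Metric.mem_closure_iff.1 hf (ε / (2 * (|C| + 1))) (by positivity)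
    filter_upwards [Metric.tendsto_nhds.1 hg (ε / 2) (by positivity)] with i hi
    have hfi := L1.integrable_coeFn f
    have hgi := L1.integrable_coeFn g
    have hfgi : Integrable (fun x => f x - g x) μ := hfi.sub hgi
    have e : ∫ x, u i x * f x ∂μ = (∫ x, u i x * g x ∂μ) + ∫ x, u i x * (f x - g x) ∂μ := by
      rw [← integral_add (key i hgi) (key i hfgi)]
      congr 1 with x
      ring
    have e2 : |∫ x, u i x * (f x - g x) ∂μ| ≤ |C| * dist f g := by
      refine (abs_integral_mul_le (hC i) hfgi).trans ?_
      rw [L1.dist_eq_integral_dist]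
      exact mul_le_mul_of_nonneg_right (le_abs_self C)
        (integral_nonneg fun x => abs_nonneg _)
    have e3 : |C| * dist f g ≤ ε / 2 := by
      rw [lt_div_iff₀ (by positivity)] at hfg
      nlinarith [dist_nonneg (x := f) (y := g)]
    rw [Real.dist_0_eq_abs] at hi ⊢
    rw [e]
    linarith [abs_add_le (∫ x, u i x * g x ∂μ) (∫ x, u i x * (f x - g x) ∂μ)]
  · intro f g hfg _ hf
    refine hf.congr fun i => integral_congr_ae ?_
    filter_upwards [hfg] with x hx
    rw [hx]

/-- For a uniformly bounded family of functions, convergence of the integrals over the rays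
`(-∞, b]` implies convergence of the integrals against every integrable function. -/
lemma tendsto_integral_mul_of_Iic {μ : Measure ℝ}
    (hm : ∀ i, AEStronglyMeasurable (u i) μ) (hC : ∀ i, ∀ᵐ x ∂μ, |u i x| ≤ C)
    (hfin : ∀ b, μ (Set.Iic b) < ∞)
    (h : ∀ b, Tendsto (fun i => ∫ x in Set.Iic b, u i x ∂μ) l (𝓝 0))
    {φ : ℝ → ℝ} (hφ : Integrable φ μ) :
    Tendsto (fun i => ∫ x, u i x * φ x ∂μ) l (𝓝 0) := by
  have hbdd : ∀ b, ∀ ψ : ℝ → ℝ, Integrable ψ μ →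
      Tendsto (fun i => ∫ x in Set.Iic b, u i x * ψ x ∂μ) l (𝓝 0) := fun b ψ hψ => by
    have : IsFiniteMeasure (μ.restrict (Set.Iic b)) := isFiniteMeasure_restrict.2 (hfin b).ne
    refine tendsto_integral_mul_of_setIntegral (fun i => (hm i).restrict)
      (fun i => ae_restrict_of_ae (hC i)) (fun s hs _ => ?_) hψ.restrict
    refine tendsto_setIntegral_of_Iic (fun i => (hm i).restrict)
      (fun i => ae_restrict_of_ae (hC i)) (h b) (fun a => ?_) hs
    simpa [Measure.restrict_restrict, Set.Iic_inter_Iic] using h (min a b)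
  -- Only the rays have finite measure, so the line is cut into countably many pieces, each inside a
  -- ray; the integrals over the pieces are dominated by those of `C * |φ|`.
  set t : ℕ → Set ℝ := disjointed fun n : ℕ => Set.Iic (n : ℝ) with ht
  have htm : ∀ n, MeasurableSet (t n) := fun n =>
    MeasurableSet.disjointed (fun n => measurableSet_Iic) n
  have hd : Pairwise (Function.onFun Disjoint t) := disjoint_disjointed _
  have hU : ⋃ n, t n = Set.univ := by
    rw [ht, iUnion_disjointed]
    exact Set.iUnion_eq_univ_iff.2 fun x => (exists_nat_ge x).imp fun n hn => hn
  have hsum : Summable fun n => C * ∫ x in t n, |φ x| ∂μ :=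
    ((hasSum_integral_iUnion htm hd hφ.abs.integrableOn).summable).mul_left C
  have := tendsto_tsum_of_dominated_convergence (f := fun i n => ∫ x in t n, u i x * φ x ∂μ)
    (g := fun _ => (0 : ℝ)) (𝓕 := l) hsum (fun n => by
      refine (hbdd n ((t n).indicator φ) (hφ.indicator (htm n))).congr fun i => ?_
      have : (fun x => u i x * (t n).indicator φ x) = (t n).indicator fun x => u i x * φ x := by
        ext x
        by_cases hx : x ∈ t n <;> simp [hx]
      rw [this, setIntegral_indicator (htm n),
        Set.inter_eq_right.2 (disjointed_subset (fun n : ℕ => Set.Iic (n : ℝ)) n)])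
    (Eventually.of_forall fun i n =>
      abs_integral_mul_le (ae_restrict_of_ae (hC i)) hφ.integrableOn)
  rw [tsum_zero] at this
  refine this.congr fun i => ?_
  rw [← integral_iUnion htm hd (integrable_mul_of_abs_le (hm i) (hC i) hφ).integrableOn, hU,
    setIntegral_univ]

end WeakConvergence

/-! ### Existence and uniqueness of `f_ω` -/

/-- A Lipschitz function that vanishes at `0` is the primitive of an element of `L^∞(ℝ_+)`. -/
lemma exists_prim_eq {G : ℝ → ℝ} {C : ℝ} (hG : ∀ a b, |G b - G a| ≤ C * |b - a|)
    (h0 : G 0 = 0) : ∃ g : LInf, ∀ x : ℝ, 0 ≤ x → prim g x = G x := by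
  have hC : 0 ≤ C := by simpa using (abs_nonneg _).trans (hG 0 1)
  have hL : LipschitzWith C.toNNReal G := LipschitzWith.of_dist_le_mul fun a b => by
    simpa [Real.dist_eq, hC] using hG b a
  -- The bound holds everywhere because `deriv` is `0` where `G` is not differentiable. A Lipschitz
  -- function is absolutely continuous, so `deriv G` integrates back to `G`.
  have hmem : MemLp (deriv G) ∞ (volume.restrict (Set.Ici (0 : ℝ))) :=
    memLp_top_of_bound (measurable_deriv G).aestronglyMeasurable C.toNNReal
      (Eventually.of_forall fun x => norm_deriv_le_of_lipschitz hL)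
  refine ⟨hmem.toLp, fun x hx => ?_⟩
  rw [prim_congr hmem.coeFn_toLp hx,
    (hL.lipschitzOnWith (s := Set.uIcc 0 x)).absolutelyContinuousOnInterval.integral_deriv_eq_sub,
    h0, sub_zero]

lemma integral_Ici_eq_ext (f : LInf) (s : ℝ≥0) (h : ℝ → ℝ) :
    ∫ x in Set.Ici (0 : ℝ), f (x + s) * h x = ∫ x in Set.Ici (0 : ℝ), ext f (x + s) * h x :=
  setIntegral_congr_fun measurableSet_Ici fun x hx => by
    have : x + s ∈ Set.Ici (0 : ℝ) := add_nonneg hx s.2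
    simp [ext, this]

lemma integral_Ici_eq_ext' (f : LInf) (h : ℝ → ℝ) :
    ∫ x in Set.Ici (0 : ℝ), f x * h x = ∫ x in Set.Ici (0 : ℝ), ext f x * h x := by
  simpa using integral_Ici_eq_ext f 0 h

lemma ae_abs_ext_add_le (f : LInf) (s : ℝ) : ∀ᵐ x, |ext f (x + s)| ≤ ‖f‖ :=
  (quasiMeasurePreserving_add_right volume s).ae (ae_abs_ext_le f)

lemma aestronglyMeasurable_ext_add (f : LInf) (s : ℝ) :
    AEStronglyMeasurable (fun x => ext f (x + s)) volume :=
  (aestronglyMeasurable_ext f).comp_quasiMeasurePreserving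
    (quasiMeasurePreserving_add_right volume s)

lemma integral_ext_add (f : LInf) (s a b : ℝ) :
    ∫ x in a..b, ext f (x + s) = prim f (b + s) - prim f (a + s) := by
  rw [intervalIntegral.integral_comp_add_right (fun x => ext f x), prim_sub]

/-- Convergence of primitives is convergence against indicators of intervals, which suffices for a
bounded family. -/
lemma isOrbitLimit_of_prim_eq {ω : Ultrafilter ℝ≥0} {f g : LInf}
    (h : ∀ x : ℝ, 0 ≤ x → prim g x = orbitPrim ω f x) : IsOrbitLimit ω f g := by
  intro φ hφ
  have hfm : ∀ s : ℝ, AEStronglyMeasurable (fun x => ext f (x + s))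
      (volume.restrict (Set.Ici 0)) := fun s => (aestronglyMeasurable_ext_add f s).restrict
  have hgm : AEStronglyMeasurable (ext g) (volume.restrict (Set.Ici 0)) :=
    (aestronglyMeasurable_ext g).restrict
  have hfC : ∀ s : ℝ, ∀ᵐ x ∂volume.restrict (Set.Ici (0 : ℝ)), |ext f (x + s)| ≤ ‖f‖ :=
    fun s => ae_restrict_of_ae (ae_abs_ext_add_le f s)
  have hgC : ∀ᵐ x ∂volume.restrict (Set.Ici (0 : ℝ)), |ext g x| ≤ ‖g‖ :=
    ae_restrict_of_ae (ae_abs_ext_le g)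
  have key := tendsto_integral_mul_of_Iic (l := (ω : Filter ℝ≥0))
    (u := fun (s : ℝ≥0) x => ext f (x + s) - ext g x) (C := ‖f‖ + ‖g‖)
    (fun s => (hfm s).sub hgm)
    (fun s => by
      filter_upwards [hfC s, hgC] with x h1 h2
      exact (abs_sub _ _).trans (add_le_add h1 h2))
    (fun b => by
      rw [Measure.restrict_apply measurableSet_Iic, Set.Iic_inter_Ici]
      exact measure_Icc_lt_top)
    (fun b => by
      simp_rw [Measure.restrict_restrict measurableSet_Iic, Set.Iic_inter_Ici]
      rcases lt_or_ge b 0 with hb | hb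
      · simp [Set.Icc_eq_empty (not_le.2 hb)]
      have := (tendsto_orbitPrim ω f b).sub_const (prim g b)
      rw [h b hb, sub_self] at this
      refine this.congr fun s => ?_
      rw [integral_Icc_eq_integral_Ioc, ← intervalIntegral.integral_of_le hb,
        intervalIntegral.integral_sub _ (intervalIntegrable_ext g _ _), integral_ext_add]
      · rw [← h b hb]
        simp [prim, add_comm]
      · simpa using (intervalIntegrable_ext f (0 + s) (b + s)).comp_add_right s)
    hφ
  have := key.add_const (∫ x in Set.Ici (0 : ℝ), ext g x * φ x)
  rw [zero_add] at this
  rw [integral_Ici_eq_ext']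
  refine this.congr fun s => ?_
  rw [integral_Ici_eq_ext, ← integral_add]
  · congr 1 with x
    ring
  · exact integrable_mul_of_abs_le ((hfm s).sub hgm) (C := ‖f‖ + ‖g‖) (by
      filter_upwards [hfC s, hgC] with x h1 h2
      exact (abs_sub _ _).trans (add_le_add h1 h2)) hφ
  · exact integrable_mul_of_abs_le hgm hgC hφ

/-- Test the weak* limit against the indicator of `(0, x]`. -/
lemma IsOrbitLimit.prim_eq {ω : Ultrafilter ℝ≥0} {f g : LInf} (h : IsOrbitLimit ω f g) {x : ℝ}
    (hx : 0 ≤ x) : prim g x = orbitPrim ω f x := by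
  have e : ∀ u : ℝ → ℝ, ∫ y in Set.Ici (0 : ℝ), u y * (Set.Ioc 0 x).indicator 1 y =
      ∫ y in (0 : ℝ)..x, u y := fun u => by
    have : (fun y => u y * (Set.Ioc 0 x).indicator 1 y) = (Set.Ioc 0 x).indicator u := by
      ext y
      by_cases hy : y ∈ Set.Ioc 0 x <;> simp [hy]
    rw [this, setIntegral_indicator measurableSet_Ioc, intervalIntegral.integral_of_le hx,
      Set.inter_eq_right.2 fun y hy => Set.mem_Ici.2 hy.1.le]
  have hint : IntegrableOn ((Set.Ioc 0 x).indicator (1 : ℝ → ℝ)) (Set.Ici 0) :=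
    (IntegrableOn.integrable_indicator (integrableOn_const (by simp)) measurableSet_Ioc).integrableOn
  have := h _ hint
  simp_rw [integral_Ici_eq_ext, integral_Ici_eq_ext', e] at this
  refine tendsto_nhds_unique this ((tendsto_orbitPrim ω f x).congr fun s => ?_)
  rw [integral_ext_add, zero_add, add_comm]

lemma isCesaroLimit_iff {ω U : Ultrafilter ℝ≥0} {φ : WeakDual ℝ LInf} :
    IsCesaroLimit ω U φ ↔ φ = cesaro ω U := by
  constructor
  · intro h
    refine DFunLike.ext _ _ fun f => ?_
    obtain ⟨g, hg, hlim⟩ := h f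
    refine tendsto_nhds_unique hlim ((tendsto_cesaro ω U f).congr fun x => ?_)
    rw [integral_zero_eq_prim g x.coe_nonneg, hg.prim_eq x.coe_nonneg]
  · rintro rfl f
    obtain ⟨g, hg⟩ := exists_prim_eq (abs_orbitPrim_sub_le ω f) (orbitPrim_zero ω f)
    refine ⟨g, isOrbitLimit_of_prim_eq hg, (tendsto_cesaro ω U f).congr fun x => ?_⟩
    rw [integral_zero_eq_prim g x.coe_nonneg, hg x x.coe_nonneg]

/-! ### Compatibility with the pointwise orbit on `C_ub` -/

lemma prim_cub (f : Cub) {x : ℝ} (hx : 0 ≤ x) :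
    prim f.toLInf x = ∫ t in (0 : ℝ)..x, f.1 t.toNNReal :=
  prim_congr (memLp_cub f).coeFn_toLp hx

lemma prim_cub_sub (f : Cub) (s : ℝ≥0) {x : ℝ} (hx : 0 ≤ x) :
    prim f.toLInf (s + x) - prim f.toLInf s = ∫ t in (0 : ℝ)..x, f.1 (s + t.toNNReal) := by
  have hc : Continuous fun t : ℝ => f.1 t.toNNReal := f.1.continuous.comp continuous_real_toNNReal
  rw [prim_cub f (by positivity), prim_cub f s.coe_nonneg,
    intervalIntegral.integral_interval_sub_left (hc.intervalIntegrable _ _)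
    (hc.intervalIntegrable _ _)]
  have := intervalIntegral.integral_comp_add_left (a := 0) (b := x)
    (fun t : ℝ => f.1 t.toNNReal) (s : ℝ)
  rw [add_zero] at this
  rw [← this]
  refine intervalIntegral.integral_congr fun t ht => ?_
  rw [Set.uIcc_of_le hx] at ht
  rw [Real.toNNReal_add s.coe_nonneg ht.1, Real.toNNReal_coe]

/-- Translates of a uniformly continuous function are equicontinuous, so their pointwise limit along
`ω` is uniform on `[0, x]` and commutes with the integral. -/
lemma orbitPrim_cub (ω : Ultrafilter ℝ≥0) (f : Cub) {x : ℝ} (hx : 0 ≤ x) :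
    orbitPrim ω f.toLInf x = ∫ t in (0 : ℝ)..x, Cub.orbit ω f t.toNNReal := by
  set F : ℝ≥0 → Set.Icc (0 : ℝ) x → ℝ := fun s t => f.1 (s + (t : ℝ).toNNReal) with hFdef
  have hFc : ∀ s, Continuous (F s) := fun s => f.1.continuous.comp
    (continuous_const.add (continuous_real_toNNReal.comp continuous_subtype_val))
  have heq : Equicontinuous F := fun t₀ => by
    refine Metric.equicontinuousAt_iff.2 fun ε hε => ?_
    obtain ⟨δ, hδ, h⟩ := Metric.uniformContinuous_iff.1 f.2 ε hε
    refine ⟨δ, hδ, fun t ht s => h ?_⟩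
    rw [dist_comm] at ht
    rw [NNReal.dist_eq]
    simpa [t.2.1, t₀.2.1, Subtype.dist_eq, Real.dist_eq] using ht
  have hunif : TendstoUniformly F (fun t => Cub.orbit ω f (t : ℝ).toNNReal) (ω : Filter ℝ≥0) := by
    refine UniformFun.tendsto_iff_tendstoUniformly.1
      ((heq.tendsto_uniformFun_iff_pi _ _).2 (tendsto_pi_nhds.2 fun t => ?_))
    exact Cub.tendsto_orbit ω f _
  have hoc : ContinuousOn (fun t : ℝ => Cub.orbit ω f t.toNNReal) (Set.Icc 0 x) :=
    continuousOn_iff_continuous_domRestrict.2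
      (hunif.continuous (Eventually.of_forall hFc).frequently)
  refine tendsto_nhds_unique (tendsto_orbitPrim ω f.toLInf x) (Metric.tendsto_nhds.2 fun ε hε => ?_)
  filter_upwards [Metric.tendstoUniformly_iff.1 hunif (ε / (x + 1)) (by positivity)] with s hs
  have hsc : Continuous fun t : ℝ => f.1 (s + t.toNNReal) :=
    f.1.continuous.comp (continuous_const.add continuous_real_toNNReal)
  rw [prim_cub_sub f s hx, Real.dist_eq, ← intervalIntegral.integral_sub
    (hsc.intervalIntegrable _ _) (hoc.intervalIntegrable_of_Icc hx), ← Real.norm_eq_abs]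
  refine (intervalIntegral.norm_integral_le_of_norm_le_const
    (C := ε / (x + 1)) fun t ht => ?_).trans_lt ?_
  · rw [Set.uIoc_of_le hx] at ht
    have := hs ⟨t, ht.1.le, ht.2⟩
    rw [dist_comm, dist_eq_norm] at this
    exact this.le
  · rw [sub_zero, abs_of_nonneg hx, div_mul_eq_mul_div, div_lt_iff₀ (by positivity)]
    nlinarith

lemma extends_iff {ω U : Ultrafilter ℝ≥0} {φ : WeakDual ℝ LInf} :
    Extends ω U φ ↔ ∀ f : Cub, φ f.toLInf = cesaro ω U f.toLInf := by
  refine forall_congr' fun f => ?_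
  have h : Tendsto (fun x : ℝ≥0 => (1 / (x : ℝ)) *
      ∫ t in (0 : ℝ)..(x : ℝ), Cub.orbit ω f t.toNNReal) U (𝓝 (cesaro ω U f.toLInf)) :=
    (tendsto_cesaro ω U f.toLInf).congr fun x => by rw [orbitPrim_cub ω f x.coe_nonneg]
  exact ⟨fun h' => tendsto_nhds_unique h' h, fun h' => h' ▸ h⟩

/-! ### Moving averages and uniqueness of the extension -/

/-- The moving average `x ↦ ∫_x^{x+1} f`, as an element of `C_ub(ℝ_+)`. -/
noncomputable def movingAvg (f : LInf) : Cub :=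
  have hL : LipschitzWith (2 * ‖f‖₊) fun x : ℝ≥0 => prim f (x + 1) - prim f x :=
    LipschitzWith.of_dist_le_mul fun x y => by
      have h1 := abs_prim_sub_le f (y + 1) (x + 1)
      have h2 := abs_prim_sub_le f y x
      rw [add_sub_add_right_eq_sub] at h1
      have h3 := abs_sub (prim f (x + 1) - prim f (y + 1)) (prim f x - prim f y)
      rw [Real.dist_eq, NNReal.dist_eq]
      push_cast
      rw [sub_sub_sub_comm]
      linarith
  ⟨BoundedContinuousFunction.ofNormedAddCommGroup
    (fun x : ℝ≥0 => prim f (x + 1) - prim f x) hL.continuous ‖f‖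
    fun x => by simpa using abs_prim_sub_le f x (x + 1), hL.uniformContinuous⟩

/-- By the sliding identity the moving average has primitive `∫_x^{x+1} F - ∫_0^1 F`; the two terms
are within `‖f‖` of `F x` and of `F 0 = 0`. -/
lemma abs_prim_sub_movingAvg_le (f : LInf) {x : ℝ} (hx : 0 ≤ x) :
    |prim (f - (movingAvg f).toLInf) x| ≤ 2 * ‖f‖ := by
  have hc := continuous_of_abs_sub_le (abs_prim_sub_le f)
  have e : prim (movingAvg f).toLInf x = ∫ t in (0 : ℝ)..x, (prim f (t + 1) - prim f t) := by
    rw [prim_cub _ hx]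
    refine intervalIntegral.integral_congr fun t ht => ?_
    rw [Set.uIcc_of_le hx] at ht
    change prim f ((t.toNNReal : ℝ) + 1) - prim f (t.toNNReal : ℝ) = _
    rw [Real.coe_toNNReal _ ht.1]
  have e' := integral_window_eq hc 0 x 1
  have h1 := abs_le.1 (abs_integral_window_sub_le (abs_prim_sub_le f) x zero_le_one)
  have h2 := abs_le.1 (abs_integral_window_sub_le (abs_prim_sub_le f) 0 zero_le_one)
  simp only [zero_add, prim_zero, mul_one, one_mul, sub_zero] at e' h1 h2
  rw [sub_eq_add_neg, prim_add, prim_neg, e, e', abs_le]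
  constructor <;> linarith [h1.1, h1.2, h2.1, h2.2]

/-- Window averages of `d` are at most `2 * B / θ`, so the upper mean is at most `0`. Applied to `d`
and `-d`, this gives `φ d = 0`. -/
lemma apply_le_zero_of_prim_bounded {φ : WeakDual ℝ LInf} (hφ : φ ∈ M1) {d : LInf} {B : ℝ}
    (hd : ∀ x : ℝ, 0 ≤ x → |prim d x| ≤ B) : φ d ≤ 0 := by
  obtain ⟨L, hL, hle⟩ := hφ.2 d
  refine hle.trans (le_of_tendsto_of_tendsto (isUpperMean_iff.1 hL)
    ((tendsto_const_nhds (x := 2 * B)).div_atTop tendsto_id) ?_)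
  filter_upwards [eventually_gt_atTop 0] with θ hθ
  refine upperAvg_le hθ ?_
  filter_upwards [eventually_ge_atTop 0] with x hx
  have h1 := abs_le.1 (hd x hx)
  have h2 := abs_le.1 (hd (x + θ) (by linarith))
  rw [id, mul_div_cancel₀ _ hθ.ne']
  linarith [h1.1, h2.2]

lemma apply_movingAvg {φ : WeakDual ℝ LInf} (hφ : φ ∈ M1) (f : LInf) :
    φ (movingAvg f).toLInf = φ f := by
  have h1 := apply_le_zero_of_prim_bounded hφ fun x hx => abs_prim_sub_movingAvg_le f hx
  have h2 := apply_le_zero_of_prim_bounded hφ (d := -(f - (movingAvg f).toLInf)) (B := 2 * ‖f‖)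
    fun x hx => by
      rw [prim_neg, abs_neg]
      exact abs_prim_sub_movingAvg_le f hx
  rw [map_neg, map_sub] at h2
  rw [map_sub] at h1
  linarith

/-- A functional in `𝓜₁` is determined by its values on `C_ub(ℝ_+)`. -/
lemma mem_M1_and_extends_iff {ω U : Ultrafilter ℝ≥0} (hω : (ω : Filter ℝ≥0) ≤ atTop)
    (hU : (U : Filter ℝ≥0) ≤ atTop) {φ : WeakDual ℝ LInf} :
    (φ ∈ M1 ∧ Extends ω U φ) ↔ φ = cesaro ω U := by
  have hces := cesaro_mem_M1 hω hU
  constructor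
  · rintro ⟨hφ, hext⟩
    refine DFunLike.ext _ _ fun f => ?_
    rw [← apply_movingAvg hφ, ← apply_movingAvg hces, extends_iff.1 hext]
  · rintro rfl
    exact ⟨hces, extends_iff.2 fun _ => rfl⟩

/-! ### Convexity and weak* closedness of `M1` -/

lemma isMean_convex : Convex ℝ {φ : WeakDual ℝ LInf | IsMean φ} := by
  intro φ hφ ψ hψ a b ha hb hab
  have e : ∀ f, (a • φ + b • ψ) f = a * φ f + b * ψ f := fun f => rfl
  refine ⟨fun f hf => ?_, ?_⟩
  · rw [e]
    exact add_nonneg (mul_nonneg ha (hφ.1 f hf)) (mul_nonneg hb (hψ.1 f hf))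
  · rw [e, hφ.2, hψ.2]
    linarith

lemma convex_M1 : Convex ℝ M1 := by
  intro φ hφ ψ hψ a b ha hb hab
  refine ⟨isMean_convex hφ.1 hψ.1 ha hb hab, fun f => ?_⟩
  obtain ⟨L, hL, h1⟩ := hφ.2 f
  obtain ⟨L', hL', h2⟩ := hψ.2 f
  obtain rfl := tendsto_nhds_unique hL hL'
  refine ⟨L, hL, ?_⟩
  change a * φ f + b * ψ f ≤ L
  calc a * φ f + b * ψ f ≤ a * L + b * L := by gcongr
    _ = L := by rw [← add_mul, hab, one_mul]

lemma isClosed_M1 : IsClosed M1 := by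
  choose L hL using exists_isUpperMean
  have e : M1 = (⋂ f : LInf, ⋂ _ : 0 ≤ f, {φ : WeakDual ℝ LInf | 0 ≤ φ f}) ∩
      {φ : WeakDual ℝ LInf | φ oneLInf = 1} ∩ ⋂ f : LInf, {φ : WeakDual ℝ LInf | φ f ≤ L f} := by
    ext φ
    simp only [M1, IsMean, Set.mem_ofPred_eq, Set.mem_inter_iff, Set.mem_iInter]
    refine and_congr_right fun _ => forall_congr' fun f => ⟨?_, fun h => ⟨L f, hL f, h⟩⟩
    rintro ⟨L', hL', h⟩
    rwa [tendsto_nhds_unique (hL f) hL']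
  rw [e]
  refine ((isClosed_iInter fun f => isClosed_iInter fun _ => ?_).inter ?_).inter
    (isClosed_iInter fun f => ?_)
  · exact isClosed_le continuous_const (WeakDual.eval_continuous f)
  · exact isClosed_eq (WeakDual.eval_continuous _) continuous_const
  · exact isClosed_le (WeakDual.eval_continuous f) continuous_const

/-! ### Points of `Ω*` that nearly attain the upper mean -/

/-- A point from which all averages up to a given length are almost as large as the upper mean. -/
lemma exists_forall_le_prim_sub {f : LInf} {L : ℝ} (hL : IsUpperMean f L) {ε : ℝ} (hε : 0 < ε)
    (M : ℝ) :
    ∃ s ≥ M, ∀ y ∈ Set.Icc 0 M, (L - 2 * ε) * y ≤ prim f (s + y) - prim f s := by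
  set c := L - 2 * ε with hc
  set K := ‖f‖ + |c| + 1 with hK
  have hKpos : 0 < K := by positivity
  have h1 : ∀ᶠ θ in atTop, L - ε < upperAvg f θ :=
    (isUpperMean_iff.1 hL).eventually (lt_mem_nhds (by linarith))
  obtain ⟨θ, hθ, hθpos, hθM⟩ :=
    (h1.and ((eventually_gt_atTop 0).and (eventually_ge_atTop (K * M / ε)))).exists
  obtain ⟨x, hx, hxM⟩ :=
    ((frequently_lt_of_lt_limsup (isCoboundedUnder_avg f hθpos) hθ).and_eventually
      (eventually_ge_atTop M)).exists
  rw [lt_div_iff₀ hθpos] at hx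
  rw [div_le_iff₀ hε] at hθM
  have hcont : Continuous fun y => prim f y - c * y :=
    (continuous_of_abs_sub_le (abs_prim_sub_le f)).sub (continuous_const.mul continuous_id)
  -- Minimality at `s` says exactly that averages from `s` to later points of the window are at
  -- least `c`.
  obtain ⟨s, hs, hmin⟩ := isCompact_Icc.exists_isMinOn
    (Set.nonempty_Icc.2 (by linarith : x ≤ x + θ)) hcont.continuousOn
  have hmin' : ∀ y ∈ Set.Icc x (x + θ), prim f s - c * s ≤ prim f y - c * y := fun y hy => hmin hy
  have h2 := hmin' x ⟨le_rfl, by linarith⟩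
  -- The minimum is not near the right end: `F y - c * y` rises from `s` to `x + θ` by at least `ε *
  -- θ ≥ K * M`, while its Lipschitz constant is at most `K`.
  have hroom : M ≤ x + θ - s := by
    have h3 := (abs_le.1 (abs_prim_sub_le f s (x + θ))).2
    rw [abs_of_nonneg (by linarith [hs.2])] at h3
    have h4 : -c * (x + θ - s) ≤ |c| * (x + θ - s) :=
      mul_le_mul_of_nonneg_right (neg_le_abs c) (by linarith [hs.2])
    have h5 : K * M ≤ K * (x + θ - s) := by
      have : 0 ≤ x + θ - s := by linarith [hs.2]
      nlinarith
    exact le_of_mul_le_mul_left h5 hKpos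
  refine ⟨s, by linarith [hs.1], fun y hy => ?_⟩
  have := hmin' (s + y) ⟨by linarith [hs.1, hy.1], by linarith [hy.2]⟩
  linarith

/-- Ultrafilters in `Ω*` come from `ℕ`, so the base point is rounded down; moving each end of the
interval by at most `1` costs `‖f‖`. -/
lemma exists_nat_forall_le_prim_sub {f : LInf} {L : ℝ} (hL : IsUpperMean f L) {ε : ℝ}
    (hε : 0 < ε) (n : ℕ) :
    ∃ k ≥ n, ∀ y ∈ Set.Icc (0 : ℝ) n,
      (L - 2 * ε) * y - 2 * ‖f‖ ≤ prim f (k + y) - prim f k := by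
  obtain ⟨s, hs, h⟩ := exists_forall_le_prim_sub hL hε n
  have hs0 : 0 ≤ s := n.cast_nonneg.trans hs
  refine ⟨⌊s⌋₊, Nat.le_floor hs, fun y hy => ?_⟩
  have hd : |s - ⌊s⌋₊| ≤ 1 := by
    rw [abs_of_nonneg (sub_nonneg.2 (Nat.floor_le hs0))]
    linarith [Nat.lt_floor_add_one s]
  have h1 := (abs_prim_sub_le f (⌊s⌋₊ : ℝ) s).trans
    (mul_le_of_le_one_right (norm_nonneg f) hd)
  have h2 := (abs_prim_sub_le f (⌊s⌋₊ + y : ℝ) (s + y)).trans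
    (mul_le_of_le_one_right (norm_nonneg f) (by rwa [add_sub_add_right_eq_sub]))
  linarith [h y hy, (abs_le.1 h1).1, (abs_le.1 h2).2]

lemma exists_omegaStar_le_orbitPrim {f : LInf} {L : ℝ} (hL : IsUpperMean f L) {ε : ℝ}
    (hε : 0 < ε) :
    ∃ ω ∈ OmegaStar, ∀ y : ℝ, 0 ≤ y → (L - 2 * ε) * y - 2 * ‖f‖ ≤ orbitPrim ω f y := by
  choose k hk h using exists_nat_forall_le_prim_sub hL hε
  have hcof : Tendsto k (hyperfilter ℕ : Filter ℕ) atTop :=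
    (tendsto_atTop_mono hk tendsto_id).mono_left Nat.hyperfilter_le_atTop
  -- Since `k n → ∞`, the image of the hyperfilter under `k` is nonprincipal. For fixed `y` the
  -- bound holds at `k n` once `n ≥ y`.
  refine ⟨((hyperfilter ℕ).map k).map (fun n : ℕ => (n : ℝ≥0) + 0),
    ⟨_, fun m hm => ?_, 0, zero_le_one, rfl⟩, fun y hy => ?_⟩
  · have h1 : {m} ∈ (hyperfilter ℕ).map k := by
      rw [hm]
      exact rfl
    obtain ⟨n, hn, hn'⟩ :=
      ((hcof.eventually (eventually_gt_atTop m)).and (Ultrafilter.mem_map.1 h1)).exists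
    exact hn.ne' hn'
  · refine ge_of_tendsto (tendsto_orbitPrim _ f y) ?_
    simp only [Ultrafilter.coe_map, eventually_map]
    obtain ⟨N, hN⟩ := exists_nat_ge y
    filter_upwards [Nat.hyperfilter_le_atTop (eventually_ge_atTop N)] with n hn
    simpa using h n y ⟨hy, hN.trans (Nat.cast_le.2 hn)⟩

lemma exists_mem_freeAtInfinity : ∃ U, U ∈ FreeAtInfinity := by
  refine ⟨Ultrafilter.of atTop, fun A hA hb => ?_⟩
  obtain ⟨r, hr⟩ := (Metric.isBounded_iff_subset_closedBall 0).1 hb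
  have h : ∀ᶠ x in (Ultrafilter.of (atTop : Filter ℝ≥0) : Filter ℝ≥0), r.toNNReal < x :=
    Ultrafilter.of_le _ (eventually_gt_atTop r.toNNReal)
  obtain ⟨x, hx, hxA⟩ := (h.and (show ∀ᶠ x in _, x ∈ A from hA)).exists
  have hxr : (x : ℝ) ≤ r := by simpa [NNReal.dist_eq] using hr hxA
  exact absurd (Real.toNNReal_le_toNNReal hxr) (by simpa using hx)

lemma mem_Q1_iff {φ : WeakDual ℝ LInf} :
    φ ∈ Q1 ↔ ∃ ω ∈ OmegaStar, ∃ U ∈ FreeAtInfinity, φ = cesaro ω U := by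
  constructor
  · rintro ⟨hφ, ω, hω, U, hU, h⟩
    exact ⟨ω, hω, U, hU, (mem_M1_and_extends_iff (le_atTop_of_mem_omegaStar hω)
      (le_atTop_of_mem_freeAtInfinity hU)).1 ⟨hφ, h⟩⟩
  · rintro ⟨ω, hω, U, hU, h⟩
    have := (mem_M1_and_extends_iff (le_atTop_of_mem_omegaStar hω)
      (le_atTop_of_mem_freeAtInfinity hU)).2 h
    exact ⟨this.1, ω, hω, U, hU, this.2⟩

lemma exists_mem_Q1_le {f : LInf} {L : ℝ} (hL : IsUpperMean f L) {ε : ℝ} (hε : 0 < ε) :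
    ∃ φ ∈ Q1, L - 2 * ε ≤ φ f := by
  obtain ⟨ω, hω, h⟩ := exists_omegaStar_le_orbitPrim hL hε
  obtain ⟨U, hU⟩ := exists_mem_freeAtInfinity
  refine ⟨cesaro ω U, mem_Q1_iff.2 ⟨ω, hω, U, hU, rfl⟩, ?_⟩
  have hcoe : Tendsto ((↑) : ℝ≥0 → ℝ) U atTop :=
    NNReal.tendsto_coe_atTop.2 (le_atTop_of_mem_freeAtInfinity hU)
  have hlim : Tendsto (fun x : ℝ≥0 => (L - 2 * ε) - 2 * ‖f‖ / (x : ℝ)) U (𝓝 (L - 2 * ε)) := by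
    simpa using (tendsto_const_nhds (x := L - 2 * ε)).sub
      ((tendsto_const_nhds (x := 2 * ‖f‖)).div_atTop hcoe)
  refine le_of_tendsto_of_tendsto hlim (tendsto_cesaro ω U f) ?_
  filter_upwards [hcoe.eventually (eventually_gt_atTop 0)] with x hx
  rw [one_div, le_inv_mul_iff₀ hx]
  refine le_trans (le_of_eq ?_) (h x hx.le)
  field_simp

/-! ### Hahn–Banach separation -/

/-- Weak*-continuous functionals on the dual are evaluations, so a separating functional is an
element of `L^∞`. -/
lemma exists_eq_eval (g : StrongDual ℝ (WeakDual ℝ LInf)) :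
    ∃ f : LInf, ∀ φ : WeakDual ℝ LInf, g φ = φ f := by
  obtain ⟨f, hf⟩ := LinearMap.dualEmbedding_surjective (topDualPairing ℝ LInf) g
  exact ⟨f, fun φ => by rw [← hf]; rfl⟩

lemma M1_eq_closure : M1 = closure (convexHull ℝ Q1) := by
  refine Set.Subset.antisymm (fun ψ hψ => ?_)
    (closure_minimal (convexHull_min (fun φ hφ => hφ.1) convex_M1) isClosed_M1)
  by_contra hnot
  have : LocallyConvexSpace ℝ (WeakDual ℝ LInf) :=
    WeakBilin.locallyConvexSpace (B := topDualPairing ℝ LInf)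
  obtain ⟨g, u, hu, hψu⟩ :=
    geometric_hahn_banach_closed_point (convex_convexHull ℝ Q1).closure isClosed_closure hnot
  obtain ⟨f, hf⟩ := exists_eq_eval g
  obtain ⟨L, hL, hle⟩ := hψ.2 f
  rw [hf] at hψu
  -- Here `u < ψ f ≤ L`, and this `ε` makes `L - 2 * ε = u`, contradicting `φ f < u` on `Q1`.
  obtain ⟨φ, hφ, h⟩ := exists_mem_Q1_le hL (ε := (L - u) / 2) (by linarith)
  have := hu φ (subset_closure (subset_convexHull ℝ Q1 hφ))
  rw [hf] at this
  linarith

end InvMean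

theorem theorem3p8 :
    (∀ ω ∈ InvMean.OmegaStar, ∀ U ∈ InvMean.FreeAtInfinity,
      (∃! φ : WeakDual ℝ InvMean.LInf, φ ∈ InvMean.M1 ∧ InvMean.Extends ω U φ) ∧
      ∀ φ : WeakDual ℝ InvMean.LInf,
        (φ ∈ InvMean.M1 ∧ InvMean.Extends ω U φ) ↔ InvMean.IsCesaroLimit ω U φ) ∧
    InvMean.M1 = closure (convexHull ℝ InvMean.Q1) := by
  refine ⟨fun ω hω U hU => ?_, InvMean.M1_eq_closure⟩
  have h := fun φ : WeakDual ℝ InvMean.LInf => InvMean.mem_M1_and_extends_iff (φ := φ)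
    (InvMean.le_atTop_of_mem_omegaStar hω) (InvMean.le_atTop_of_mem_freeAtInfinity hU)
  exact ⟨⟨InvMean.cesaro ω U, (h _).2 rfl, fun φ hφ => (h φ).1 hφ⟩,
    fun φ => (h φ).trans InvMean.isCesaroLimit_iff.symm⟩
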